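/- Let $\mathsf{At}$ be a non-empty set of atoms and $I$ a non-empty set of individuals. The language $\mathcal L$ is given by $\varphi ::= \top \mid p \mid \neg\varphi \mid \varphi\wedge\varphi \mid \ell_i\varphi \mid a_i\varphi \mid k_i\varphi$ ($p\in\mathsf{At}$, $i\in I$; implicit knowledge, awareness, explicit knowledge), with $\varphi\to\psi := \neg(\varphi\wedge\neg\psi)$ and $\leftrightarrow$ as usual. $\mathsf{At}(\varphi)$ is the set of atoms occurring in $\varphi$ and $\mathcal L_\Phi=\{\varphi : \mathsf{At}(\varphi)\subseteq\Phi\}$. **Logic.** LPA is the smallest set of formulas that contains all substitution instances of propositional tautologies (including $\top$) and all instances of $(\ell_i\varphi\wedge\ell_i(\varphi\to\psi))\to\ell_i\psi$; $k_i\varphi\leftrightarrow(\ell_i\varphi\wedge a_i\varphi)$; $a_i(\varphi\wedge\psi)\leftrightarrow(a_i\varphi\wedge a_i\psi)$; $a_i\neg\varphi\leftrightarrow a_i\varphi$; $a_ik_j\varphi\leftrightarrow a_i\varphi$; $a_ia_j\varphi\leftrightarrow a_i\varphi$; $a_i\ell_j\varphi\leftrightarrow a_i\varphi$; $a_i\varphi\to\ell_ia_i\varphi$;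 $\neg a_i\varphi\to\ell_i\neg a_i\varphi$; $\ell_i\varphi\to\varphi$; $\ell_i\varphi\to\ell_i\ell_i\varphi$; $\neg\ell_i\varphi\to\ell_i\neg\ell_i\varphi$, and is closed under modus ponens and under passing from $\varphi$ to $\ell_i\varphi$. $\mathrm{LPA}_\top$ is defined in the same way with the additional axioms $a_i\top$ ($i\in I$). **FH models.** An FH model $\mathsf K_\Phi$ for $\Phi\subseteq\mathsf{At}$ has a non-empty set $W_\Phi$ of states, equivalence relations $R_{\Phi,i}$ on $W_\Phi$, awareness sets $\mathcal A_{\Phi,i}(w)\subseteq\mathcal L_\Phi$ and a valuation $V_\Phi:\Phi\to 2^{W_\Phi}$, such that a formula $\varphi\in\mathcal L_\Phi$ is in $\mathcal A_{\Phi,i}(w)$ iff all $p\in\mathsf{At}(\varphi)$ are, and $(w,t)\in R_{\Phi,i}$ implies $\mathcal A_{\Phi,i}(w)=\mathcal A_{\Phi,i}(t)$. For formulas in $\mathcal L_\Phi$, truth of atoms is given by $V_\Phi$, the Boolean clauses are the usual ones, $a_i\varphi$ is true at $w$ iff $\varphi\in\mathcal A_{\Phi,i}(w)$, $\ell_i\varphi$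 iff $\varphi$ is true at all $t$ with $(w,t)\in R_{\Phi,i}$, and $k_i\varphi$ iff both $\ell_i\varphi$ and $a_i\varphi$ are. A category of FH models consists of an FH model $\mathsf K_\Phi$ for every $\Phi\subseteq\mathsf{At}$ and maps $f^\Phi_\Psi:W_\Phi\to W_\Psi$ for $\Psi\subseteq\Phi$, with $f^\Phi_\Phi=\mathrm{id}$ and $f^\Phi_\Upsilon=f^\Psi_\Upsilon\circ f^\Phi_\Psi$, that are surjective bounded morphisms: they are surjective, preserve and reflect the atoms in $\Psi$, satisfy $\mathcal A_{\Phi,i}(w)\cap\mathcal L_\Psi=\mathcal A_{\Psi,i}(f^\Phi_\Psi(w))$, are homomorphisms for the relations, and satisfy the back condition: if $(f^\Phi_\Psi(w),t')\in R_{\Psi,i}$ then $t'=f^\Phi_\Psi(t)$ for some $t$ with $(w,t)\in R_{\Phi,i}$. A formula $\varphi$ is valid in the category if it is true at every state of every $\mathsf K_\Psi$ with $\mathsf{At}(\varphi)\subseteq\Psi$. **State spaces and events.** A projective system of state spaces consists of non-empty disjoint sets $S_\Phi$ ($\Phi\subseteq\mathsf{At}$) with union $\Omega$ and surjections $r^\Phi_\Psi:S_\Phi\to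 S_\Psi$ ($\Psi\subseteq\Phi$) with $r^\Phi_\Phi=\mathrm{id}$ and $r^\Phi_\Upsilon=r^\Psi_\Upsilon\circ r^\Phi_\Psi$; write $\omega_\Psi=r^\Phi_\Psi(\omega)$ for $\omega\in S_\Phi$, let $D_\Psi$ be the set of the projections to $S_\Psi$ of the elements of $D$, and let $D^\uparrow$ be the set of the states that project to an element of $D$. An event is a set $D^\uparrow$ with $D\subseteq S_\Phi$, together with its base-space $S_\Phi$; its negation is $(S_\Phi\setminus D)^\uparrow$ with the same base-space, and the base-space of $E\cap F$ is $S_{\Phi\cup\Psi}$ if $E,F$ have base-spaces $S_\Phi,S_\Psi$. A valuation $v$ maps atoms to events. **Complemented HMS models.** These have a projective system of state spaces, a valuation $v$, and for each $i$ maps $\Pi_i:\Omega\to2^\Omega\setminus\{\emptyset\}$ and $\Lambda_i:\Omega\to2^\Omega$ such that, for all $\omega\in S_\Phi$: $\Pi_i(\omega)\subseteq S_\Psi$ for some $\Psi\subseteq\Phi$ (write $S_{\Pi_i(\omega)}=S_\Psi$); $\omega\in\Pi_i(\omega)^\uparrow$; $\omega'\in\Pi_i(\omega)$ implies $\Pi_i(\omega')=\Pi_i(\omega)$;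 $\Pi_i(\omega)^\uparrow\subseteq\Pi_i(\omega_\Psi)^\uparrow$ for $\Psi\subseteq\Phi$; $\Pi_i(\omega)_\Upsilon=\Pi_i(\omega_\Upsilon)$ if $\Pi_i(\omega)\subseteq S_\Psi$ and $\Upsilon\subseteq\Psi\subseteq\Phi$; $\omega\in\Lambda_i(\omega)$; $\omega'\in\Lambda_i(\omega)$ implies $\Lambda_i(\omega')=\Lambda_i(\omega)$ and $\Pi_i(\omega')=\Pi_i(\omega)$; $\Lambda_i(\omega)_\Psi=\Lambda_i(\omega_\Psi)$ for $\Psi\subseteq\Phi$ (so $\Lambda_i(\omega)\subseteq S_\Phi$); $\omega'\in\Pi_i(\omega)$ implies $\Lambda_i(\omega')=\Lambda_i(\omega)_{S_{\Pi_i(\omega)}}$. With $[\varphi]$ the event that $\varphi$ is true and $S([\varphi])$ its base-space: $[\top]=\Omega$ (base-space $S_\emptyset$), $[p]=v(p)$, $[\neg\varphi]=\neg[\varphi]$, $[\varphi\wedge\psi]=[\varphi]\cap[\psi]$, and $\ell_i\varphi$, $k_i\varphi$, $a_i\varphi$ are true at $\omega$ iff $\Lambda_i(\omega)\subseteq[\varphi]$,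 $\Pi_i(\omega)\subseteq[\varphi]$, and $S_{\Pi_i(\omega)}$ is at least as expressive as $S([\varphi])$ (its index contains that of $S([\varphi])$), respectively; the last three events have base-space $S([\varphi])$. **Implicit knowledge-based HMS models.** These have a projective system of state spaces, a valuation, maps $\Lambda_i$ with $\omega\in\Lambda_i(\omega)$, $\Lambda_i(\omega')=\Lambda_i(\omega)$ for $\omega'\in\Lambda_i(\omega)$ and $\Lambda_i(\omega)_\Psi=\Lambda_i(\omega_\Psi)$ for $\omega\in S_\Phi$, $\Psi\subseteq\Phi$, and awareness functions $\alpha_i:\Omega\to2^{\mathsf{At}}$ (indices of spaces) such that for $\omega\in S_\Phi$: $\alpha_i(\omega)\subseteq\Phi$; $\alpha_i(\omega')=\alpha_i(\omega)$ for $\omega'\in\Lambda_i(\omega)$; $\alpha_i(\omega_\Psi)=\Psi$ if $\Psi\subseteq\alpha_i(\omega)$; $\alpha_i(\omega_\Psi)=\alpha_i(\omega)$ if $\alpha_i(\omega)\subseteq\Psi\subseteq\Phi$; $\alpha_i(\omega_\Psi)\subseteq\alpha_i(\omega)$ if $\Psi\subseteq\Phi$. Truth is as above with $\Pi_i(\omega):=\Lambda_i(\omega)_{\alpha_i(\omega)}$,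 except that $a_i\varphi$ is true at $\omega$ iff $\alpha_i(\omega)$ contains the index of $S([\varphi])$. In both kinds of HMS models $\varphi$ is defined at $\omega$ if $\omega\in v(p)\cup\neg v(p)$ for all $p\in\mathsf{At}(\varphi)$, and $\varphi$ is valid in the model if it is true at all states at which it is defined. A formula is valid in a class if it is valid in every member. **Theorem.** Consider each of the following classes: (1) all categories of FH models, (2) all complemented HMS models, (3) all implicit knowledge-based HMS models. (a) $\mathrm{LPA}_\top$ is sound and complete with respect to the class: a formula $\varphi\in\mathcal L$ belongs to $\mathrm{LPA}_\top$ if and only if it is valid in the class. (b) LPA is sound with respect to the class, and it is complete for the formulas in which $\top$ does not occur in the scope of an operator $a_i$ or $k_i$: every such formula that is valid in the class belongs to LPA. -/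

import Mathlib

universe u v w

/-! ### The language -/

/-- Formulas over the atoms `At` and the individuals `I`: implicit knowledge `ell i`,
awareness `aware i`, explicit knowledge `know i`. -/
inductive Formula (At : Type u) (I : Type v) : Type (max u v)
  | top : Formula At I
  | atom : At → Formula At I
  | neg : Formula At I → Formula At I
  | conj : Formula At I → Formula At I → Formula At I
  | ell : I → Formula At I → Formula At I
  | aware : I → Formula At I → Formula At I
  | know : I → Formula At I → Formula At I

namespace Formula

variable {At : Type u} {I : Type v}

/-- `φ → ψ` abbreviates `¬(φ ∧ ¬ψ)`. -/
def imp (φ ψ : Formula At I) : Formula At I := neg (conj φ (neg ψ))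

/-- `φ ↔ ψ` abbreviates `(φ → ψ) ∧ (ψ → φ)`. -/
def biimp (φ ψ : Formula At I) : Formula At I := conj (imp φ ψ) (imp ψ φ)

/-- The set of atoms occurring in a formula. -/
def atoms : Formula At I → Set At
  | top => ∅
  | atom p => {p}
  | neg φ => atoms φ
  | conj φ ψ => atoms φ ∪ atoms ψ
  | ell _ φ => atoms φ
  | aware _ φ => atoms φ
  | know _ φ => atoms φ

/-- The sublanguage of the formulas all of whose atoms are in `Φ`. -/
def sublanguage (Φ : Set At) : Set (Formula At I) := {φ | φ.atoms ⊆ Φ}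

/-- Evaluation in propositional logic: atoms and formulas that start with a modal operator
are treated as propositional letters, with truth values given by `e`. -/
def propEval (e : Formula At I → Prop) : Formula At I → Prop
  | top => True
  | neg φ => ¬ propEval e φ
  | conj φ ψ => propEval e φ ∧ propEval e ψ
  | atom p => e (atom p)
  | ell i φ => e (ell i φ)
  | aware i φ => e (aware i φ)
  | know i φ => e (know i φ)

/-- Substitution instances of propositional tautologies. -/
def IsTautology (φ : Formula At I) : Prop := ∀ e : Formula At I → Prop, propEval e φ

/-- The constant `⊤` does not occur. -/
def TopFree : Formula At I → Prop
  | top => False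
  | atom _ => True
  | neg φ => TopFree φ
  | conj φ ψ => TopFree φ ∧ TopFree ψ
  | ell _ φ => TopFree φ
  | aware _ φ => TopFree φ
  | know _ φ => TopFree φ

/-- The constant `⊤` does not occur in the scope of an awareness or explicit knowledge operator. -/
def TopGuarded : Formula At I → Prop
  | top => True
  | atom _ => True
  | neg φ => TopGuarded φ
  | conj φ ψ => TopGuarded φ ∧ TopGuarded ψ
  | ell _ φ => TopGuarded φ
  | aware _ φ => TopFree φ
  | know _ φ => TopFree φ

end Formula

/-! ### The Logic of Propositional Awareness -/

open Formula in
/-- Derivability from the axioms and rules of the Logic of Propositional Awareness together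
with the additional axioms in `X`. -/
inductive LPAWith {At : Type u} {I : Type v} (X : Set (Formula At I)) : Formula At I → Prop
  | extra {φ} : φ ∈ X → LPAWith X φ
  | taut {φ} : IsTautology φ → LPAWith X φ
  | axK (i φ ψ) : LPAWith X (imp (conj (ell i φ) (ell i (imp φ ψ))) (ell i ψ))
  | explicitKnowledge (i φ) :
      LPAWith X (biimp (know i φ) (conj (ell i φ) (aware i φ)))
  | axA1 (i φ ψ) :
      LPAWith X (biimp (aware i (conj φ ψ)) (conj (aware i φ) (aware i ψ)))
  | axA2 (i φ) : LPAWith X (biimp (aware i (neg φ)) (aware i φ))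
  | axA3 (i j φ) : LPAWith X (biimp (aware i (know j φ)) (aware i φ))
  | axA4 (i j φ) : LPAWith X (biimp (aware i (aware j φ)) (aware i φ))
  | axA5 (i j φ) : LPAWith X (biimp (aware i (ell j φ)) (aware i φ))
  | axA11 (i φ) : LPAWith X (imp (aware i φ) (ell i (aware i φ)))
  | axA12 (i φ) : LPAWith X (imp (neg (aware i φ)) (ell i (neg (aware i φ))))
  | modusPonens {φ ψ} : LPAWith X φ → LPAWith X (imp φ ψ) → LPAWith X ψ
  | necessitation (i) {φ} : LPAWith X φ → LPAWith X (ell i φ)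
  | axT (i φ) : LPAWith X (imp (ell i φ) φ)
  | ax4 (i φ) : LPAWith X (imp (ell i φ) (ell i (ell i φ)))
  | ax5 (i φ) : LPAWith X (imp (neg (ell i φ)) (ell i (neg (ell i φ))))

/-- The Logic of Propositional Awareness. -/
def LPA (At : Type u) (I : Type v) : Set (Formula At I) := {φ | LPAWith ∅ φ}

/-- The Logic of Propositional Awareness with the axioms `a_i ⊤` for all individuals `i`. -/
def LPATop (At : Type u) (I : Type v) : Set (Formula At I) :=
  {φ | LPAWith (Set.range fun i : I => Formula.aware i Formula.top) φ}

/-! ### FH models and categories of FH models -/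

/-- A partitional and propositionally determined FH model for `Φ ⊆ At`. -/
structure FHModel (At : Type u) (I : Type v) (Φ : Set At) where
  /-- states -/
  W : Type w
  nonempty : Nonempty W
  /-- accessibility relations -/
  R : I → W → W → Prop
  /-- awareness sets -/
  A : I → W → Set (Formula At I)
  /-- valuation -/
  V : Φ → Set W
  A_subset : ∀ i x, A i x ⊆ Formula.sublanguage Φ
  /-- awareness is generated by primitive propositions -/
  generated : ∀ i x, ∀ φ ∈ Formula.sublanguage Φ,
    φ ∈ A i x ↔ ∀ p ∈ φ.atoms, Formula.atom p ∈ A i x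
  /-- agents know what they are aware of -/
  knowAware : ∀ i x y, R i x y → A i x = A i y
  partitional : ∀ i, Equivalence (R i)

/-- Satisfaction in an FH model for `Φ`; only meant for formulas of the sublanguage of `Φ`. -/
def FHModel.Sat {At : Type u} {I : Type v} {Φ : Set At} (K : FHModel.{u, v, w} At I Φ) :
    Formula At I → K.W → Prop
  | .top, _ => True
  | .atom p, x => ∃ h : p ∈ Φ, x ∈ K.V ⟨p, h⟩
  | .neg φ, x => ¬ K.Sat φ x
  | .conj φ ψ, x => K.Sat φ x ∧ K.Sat ψ x
  | .ell i φ, x => ∀ y, K.R i x y → K.Sat φ y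
  | .aware i φ, x => φ ∈ K.A i x
  | .know i φ, x => (∀ y, K.R i x y → K.Sat φ y) ∧ φ ∈ K.A i x

/-- Surjective bounded morphisms from an FH model for `Φ` to one for `Ψ ⊆ Φ`. -/
structure IsSurjBoundedMorphism {At : Type u} {I : Type v} {Φ Ψ : Set At} (h : Ψ ⊆ Φ)
    (K : FHModel.{u, v, w} At I Φ) (K' : FHModel.{u, v, w} At I Ψ) (f : K.W → K'.W) :
    Prop where
  surjective : Function.Surjective f
  atomicHarmony : ∀ (p : Ψ) (x : K.W), x ∈ K.V ⟨p, h p.2⟩ ↔ f x ∈ K'.V p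
  awarenessConsistency : ∀ i x, K.A i x ∩ Formula.sublanguage Ψ = K'.A i (f x)
  homomorphism : ∀ i x y, K.R i x y → K'.R i (f x) (f y)
  back : ∀ i x y', K'.R i (f x) y' → ∃ y, f y = y' ∧ K.R i x y

/-- A category of FH models. -/
structure FHCategory (At : Type u) (I : Type v) where
  K : ∀ Φ : Set At, FHModel.{u, v, w} At I Φ
  f : ∀ {Φ Ψ : Set At}, Ψ ⊆ Φ → (K Φ).W → (K Ψ).W
  morphism : ∀ {Φ Ψ : Set At} (h : Ψ ⊆ Φ), IsSurjBoundedMorphism h (K Φ) (K Ψ) (f h)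
  f_id : ∀ {Φ : Set At} (h : Φ ⊆ Φ) (x : (K Φ).W), f h x = x
  f_comp : ∀ {Φ Ψ Υ : Set At} (h : Ψ ⊆ Φ) (h' : Υ ⊆ Ψ) (x : (K Φ).W),
    f (h'.trans h) x = f h' (f h x)

/-- Validity in a category of FH models: truth at every state of every model of the category in
which the formula is defined. -/
def FHCategory.Valid {At : Type u} {I : Type v} (C : FHCategory.{u, v, w} At I)
    (φ : Formula At I) : Prop :=
  ∀ Ψ : Set At, φ.atoms ⊆ Ψ → ∀ x : (C.K Ψ).W, (C.K Ψ).Sat φ x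

/-! ### Lattices of state spaces with projections -/

/-- Nonempty state spaces `S Φ`, one for each `Φ ⊆ At`, with commuting surjective projections. -/
structure StateSpaces (At : Type u) where
  S : Set At → Type w
  nonempty : ∀ Φ, Nonempty (S Φ)
  r : ∀ {Φ Ψ : Set At}, Ψ ⊆ Φ → S Φ → S Ψ
  r_surjective : ∀ {Φ Ψ : Set At} (h : Ψ ⊆ Φ), Function.Surjective (r h)
  r_id : ∀ {Φ : Set At} (h : Φ ⊆ Φ) (s : S Φ), r h s = s
  r_comp : ∀ {Φ Ψ Υ : Set At} (h : Ψ ⊆ Φ) (h' : Υ ⊆ Ψ) (s : S Φ),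
    r (h'.trans h) s = r h' (r h s)

namespace StateSpaces

variable {At : Type u} {I : Type v} (L : StateSpaces.{u, w} At)

/-- The disjoint union `Ω` of all state spaces; `ω.1` is the index of the space of `ω`. -/
abbrev Ω : Type (max u w) := Σ Φ : Set At, L.S Φ

/-- The space with index `Φ`, as a subset of `Ω`. -/
def space (Φ : Set At) : Set L.Ω := {ω | ω.1 = Φ}

/-- The projection `ω_Ψ`. -/
abbrev proj (ω : L.Ω) (Ψ : Set At) (h : Ψ ⊆ ω.1) : L.Ω := ⟨Ψ, L.r h ω.2⟩

/-- The projection `D_Ψ` of a set of states to the space with index `Ψ`. -/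
def projSet (D : Set L.Ω) (Ψ : Set At) : Set L.Ω :=
  {ω' | ∃ ω ∈ D, ∃ h : Ψ ⊆ ω.1, ω' = L.proj ω Ψ h}

/-- `D↑`, the set of all states that project to a state in `D`. -/
def up (D : Set L.Ω) : Set L.Ω :=
  {ω' | ∃ ω ∈ D, ∃ h : ω.1 ⊆ ω'.1, L.proj ω' ω.1 h = ω}

/-- An event is given by (the index of) its base-space and its base; so the vacuous events
with different base-spaces are different. -/
structure Event where
  baseSpace : Set At
  base : Set (L.S baseSpace)

variable {L}

/-- The set of states of an event: all states that project into the base. -/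
def Event.states (E : L.Event) : Set L.Ω :=
  {ω | ∃ h : E.baseSpace ⊆ ω.1, L.r h ω.2 ∈ E.base}

/-- Negation of events: complement of the base in the base-space. -/
def Event.neg (E : L.Event) : L.Event := ⟨E.baseSpace, E.baseᶜ⟩

/-- The (index of the) base-space `S([φ])` of the event `[φ]`. The base-space of a conjunction is
the join of the base-spaces; negation, knowledge and awareness keep the base-space. -/
def baseSpaceOf (val : At → L.Event) : Formula At I → Set At
  | .top => ∅
  | .atom p => (val p).baseSpace
  | .neg φ => baseSpaceOf val φ
  | .conj φ ψ => baseSpaceOf val φ ∪ baseSpaceOf val ψ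
  | .ell _ φ => baseSpaceOf val φ
  | .aware _ φ => baseSpaceOf val φ
  | .know _ φ => baseSpaceOf val φ

/-- Satisfaction, for a valuation, implicit and explicit possibility correspondences `Lam` and `Pi`,
and a relation `aw i ω Φ` saying that the awareness level of `i` at `ω` is at least as
expressive as the space with index `Φ`. -/
def Sat (val : At → L.Event) (Lam Pi : I → L.Ω → Set L.Ω) (aw : I → L.Ω → Set At → Prop) :
    Formula At I → L.Ω → Prop
  | .top, _ => True
  | .atom p, ω => ω ∈ (val p).states
  | .neg φ, ω =>
      ω ∈ (Event.neg ⟨baseSpaceOf val φ, {s | Sat val Lam Pi aw φ ⟨_, s⟩}⟩).states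
  | .conj φ ψ, ω => Sat val Lam Pi aw φ ω ∧ Sat val Lam Pi aw ψ ω
  | .ell i φ, ω => Lam i ω ⊆ {ω' | Sat val Lam Pi aw φ ω'}
  | .aware i φ, ω => aw i ω (baseSpaceOf val φ)
  | .know i φ, ω => Pi i ω ⊆ {ω' | Sat val Lam Pi aw φ ω'}

/-- `φ` is defined at `ω`. -/
def DefinedAt (val : At → L.Event) (φ : Formula At I) (ω : L.Ω) : Prop :=
  ∀ p ∈ φ.atoms, ω ∈ (val p).states ∪ (val p).neg.states

end StateSpaces

/-! ### Complemented HMS models -/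

/-- HMS models, with the standing properties of the possibility correspondences. -/
structure HMSModel (At : Type u) (I : Type v) extends StateSpaces.{u, w} At where
  /-- explicit possibility correspondences -/
  Pi : I → toStateSpaces.Ω → Set toStateSpaces.Ω
  Pi_nonempty : ∀ i ω, (Pi i ω).Nonempty
  /-- valuation -/
  val : At → toStateSpaces.Event
  confinement : ∀ i ω, ∃ Ψ ⊆ ω.1, Pi i ω ⊆ toStateSpaces.space Ψ
  generalizedReflexivity : ∀ i ω, ω ∈ toStateSpaces.up (Pi i ω)
  stationarity : ∀ i ω, ∀ ω' ∈ Pi i ω, Pi i ω' = Pi i ω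
  projectionsPreserveIgnorance : ∀ i ω Ψ (h : Ψ ⊆ ω.1),
    toStateSpaces.up (Pi i ω) ⊆ toStateSpaces.up (Pi i (toStateSpaces.proj ω Ψ h))
  projectionsPreserveKnowledge : ∀ i ω Ψ Υ (h : Ψ ⊆ ω.1) (h' : Υ ⊆ Ψ),
    Pi i ω ⊆ toStateSpaces.space Ψ →
      toStateSpaces.projSet (Pi i ω) Υ = Pi i (toStateSpaces.proj ω Υ (h'.trans h))

/-- Complemented HMS models. Strong confinement, `Lam i ω ⊆ space ω.1`, is the case `Ψ = ω.1` of
`Lam_projections` (projections preserve implicit knowledge). -/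
structure ComplementedHMSModel (At : Type u) (I : Type v) extends HMSModel.{u, v, w} At I where
  /-- implicit possibility correspondences -/
  Lam : I → toStateSpaces.Ω → Set toStateSpaces.Ω
  Lam_reflexivity : ∀ i ω, ω ∈ Lam i ω
  Lam_stationarity : ∀ i ω, ∀ ω' ∈ Lam i ω, Lam i ω' = Lam i ω
  Lam_projections : ∀ i ω Ψ (h : Ψ ⊆ ω.1),
    toStateSpaces.projSet (Lam i ω) Ψ = Lam i (toStateSpaces.proj ω Ψ h)
  explicitMeasurability : ∀ i ω, ∀ ω' ∈ Lam i ω, Pi i ω' = Pi i ω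
  implicitMeasurability : ∀ i ω Ψ, Pi i ω ⊆ toStateSpaces.space Ψ →
    ∀ ω' ∈ Pi i ω, Lam i ω' = toStateSpaces.projSet (Lam i ω) Ψ

/-- Satisfaction in a complemented HMS model; awareness at `ω` is given by the space that
contains `Pi i ω`. -/
def ComplementedHMSModel.Sat {At : Type u} {I : Type v} (M : ComplementedHMSModel.{u, v, w} At I)
    (φ : Formula At I) (ω : M.Ω) : Prop :=
  StateSpaces.Sat M.val M.Lam M.Pi
    (fun i ω Φ => ∃ Ψ, M.Pi i ω ⊆ M.space Ψ ∧ Φ ⊆ Ψ) φ ω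

/-- Validity in a complemented HMS model: truth at all states at which the formula is defined. -/
def ComplementedHMSModel.Valid {At : Type u} {I : Type v}
    (M : ComplementedHMSModel.{u, v, w} At I) (φ : Formula At I) : Prop :=
  ∀ ω : M.Ω, StateSpaces.DefinedAt M.val φ ω → M.Sat φ ω

/-! ### Implicit knowledge-based HMS models -/

/-- Implicit knowledge-based HMS models. The awareness function gives the index of a space. -/
structure ImplicitHMSModel (At : Type u) (I : Type v) extends StateSpaces.{u, w} At where
  /-- implicit possibility correspondences -/
  Lam : I → toStateSpaces.Ω → Set toStateSpaces.Ω
  /-- awareness functions -/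
  α : I → toStateSpaces.Ω → Set At
  /-- valuation -/
  val : At → toStateSpaces.Event
  Lam_reflexivity : ∀ i ω, ω ∈ Lam i ω
  Lam_stationarity : ∀ i ω, ∀ ω' ∈ Lam i ω, Lam i ω' = Lam i ω
  Lam_projections : ∀ i ω Ψ (h : Ψ ⊆ ω.1),
    toStateSpaces.projSet (Lam i ω) Ψ = Lam i (toStateSpaces.proj ω Ψ h)
  lackOfConception : ∀ i ω, α i ω ⊆ ω.1
  awarenessMeasurability : ∀ i ω, ∀ ω' ∈ Lam i ω, α i ω' = α i ω
  α_proj_below : ∀ i ω Ψ (h : Ψ ⊆ ω.1), Ψ ⊆ α i ω → α i (toStateSpaces.proj ω Ψ h) = Ψ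
  α_proj_above : ∀ i ω Ψ (h : Ψ ⊆ ω.1), α i ω ⊆ Ψ →
    α i (toStateSpaces.proj ω Ψ h) = α i ω
  α_proj_mono : ∀ i ω Ψ (h : Ψ ⊆ ω.1), α i (toStateSpaces.proj ω Ψ h) ⊆ α i ω

/-- The derived explicit possibility correspondence: the implicit possibility set projected to
the awareness level. -/
def ImplicitHMSModel.derivedPi {At : Type u} {I : Type v} (M : ImplicitHMSModel.{u, v, w} At I)
    (i : I) (ω : M.Ω) : Set M.Ω :=
  M.projSet (M.Lam i ω) (M.α i ω)

/-- Satisfaction in an implicit knowledge-based HMS model. -/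
def ImplicitHMSModel.Sat {At : Type u} {I : Type v} (M : ImplicitHMSModel.{u, v, w} At I)
    (φ : Formula At I) (ω : M.Ω) : Prop :=
  StateSpaces.Sat M.val M.Lam M.derivedPi (fun i ω Φ => Φ ⊆ M.α i ω) φ ω

/-- Validity in an implicit knowledge-based HMS model: truth at all states at which the formula is
defined. -/
def ImplicitHMSModel.Valid {At : Type u} {I : Type v} (M : ImplicitHMSModel.{u, v, w} At I)
    (φ : Formula At I) : Prop :=
  ∀ ω : M.Ω, StateSpaces.DefinedAt M.val φ ω → M.Sat φ ω

/-! ### Soundness and completeness -/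

/-- Every formula of the logic `Λ` is valid. -/
def Sound {At : Type u} {I : Type v} (Λ : Set (Formula At I)) (Valid : Formula At I → Prop) :
    Prop :=
  ∀ φ, φ ∈ Λ → Valid φ

/-- Every valid formula of the language `F` is in the logic `Λ`. -/
def CompleteFor {At : Type u} {I : Type v} (F Λ : Set (Formula At I))
    (Valid : Formula At I → Prop) : Prop :=
  ∀ φ ∈ F, Valid φ → φ ∈ Λ

/-- Validity in the class of categories of FH models. -/
def ValidFHCategories {At : Type u} {I : Type v} (φ : Formula At I) : Prop :=
  ∀ C : FHCategory.{u, v, w} At I, C.Valid φ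

/-- Validity in the class of complemented HMS models. -/
def ValidComplementedHMS {At : Type u} {I : Type v} (φ : Formula At I) : Prop :=
  ∀ M : ComplementedHMSModel.{u, v, w} At I, M.Valid φ

/-- Validity in the class of implicit knowledge-based HMS models. -/
def ValidImplicitHMS {At : Type u} {I : Type v} (φ : Formula At I) : Prop :=
  ∀ M : ImplicitHMSModel.{u, v, w} At I, M.Valid φ

/-! ### Truth in FH models -/

/-! Everything reduces to FH models for the full set of atoms, where every formula makes sense.

Soundness. Over the full set of atoms the axioms can be checked directly (`LPATop_sound_FHModel`);
`a_i ⊤` holds because `⊤` has no atoms to be aware of. In each class a state is the image of a state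
over the full set of atoms, and truth of a defined formula does not change on the way. For
categories this is `FHModel.sat_map`. For implicit knowledge-based models, the top space is itself
an FH model (`topFHModel`) and projections preserve truth (`sat_proj_iff`). A complemented model has
the same truths as an implicit one, because its explicit possibility sets are the implicit ones
projected to the awareness level (`Pi_eq_projSet_Lam`). Soundness of LPA follows, since it is
contained in the stronger logic.

Completeness. An FH model over the full set of atoms generates a member of each class by copying its
states into every space, with identity maps as projections. Hence validity in any of the classes
implies truth in all such FH models, in particular in the canonical model of maximal theories. The
truth lemma there needs awareness of a formula to be equivalent to awareness of its atoms. The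
axioms give this by induction, except at `⊤`: there one needs either the axioms `a_i ⊤`, or that `⊤`
does not occur under awareness or explicit knowledge. -/

namespace FHModel

variable {At : Type u} {I : Type v} {Φ : Set At} (K : FHModel.{u, v, w} At I Φ)

theorem sat_imp (φ ψ : Formula At I) (x : K.W) :
    K.Sat (.imp φ ψ) x ↔ (K.Sat φ x → K.Sat ψ x) := by
  simp only [Formula.imp, Sat]; tauto

theorem sat_biimp (φ ψ : Formula At I) (x : K.W) :
    K.Sat (.biimp φ ψ) x ↔ (K.Sat φ x ↔ K.Sat ψ x) := by
  simp only [Formula.biimp, Sat, sat_imp]; tauto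

/-- Truth at a fixed state is a propositional evaluation, which makes tautologies true. -/
theorem propEval_sat (φ : Formula At I) (x : K.W) :
    Formula.propEval (fun ψ => K.Sat ψ x) φ ↔ K.Sat φ x := by
  induction φ with
  | neg φ ih => simp only [Formula.propEval, Sat, ih]
  | conj φ ψ ih₁ ih₂ => simp only [Formula.propEval, Sat, ih₁, ih₂]
  | _ => simp only [Formula.propEval, Sat]

/-- Truth is invariant under surjective bounded morphisms. -/
theorem sat_map {Ψ : Set At} {h : Ψ ⊆ Φ} {K' : FHModel.{u, v, w} At I Ψ} {f : K.W → K'.W}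
    (hf : IsSurjBoundedMorphism h K K' f) (φ : Formula At I) (hφ : φ.atoms ⊆ Ψ) (x : K.W) :
    K'.Sat φ (f x) ↔ K.Sat φ x := by
  have aware_iff (i : I) (ψ : Formula At I) (hψ : ψ.atoms ⊆ Ψ) (x : K.W) :
      ψ ∈ K'.A i (f x) ↔ ψ ∈ K.A i x := by
    rw [← hf.awarenessConsistency]
    exact ⟨fun h => h.1, fun h => ⟨h, hψ⟩⟩
  have box_iff (i : I) (ψ : Formula At I) (ih : ∀ x, K'.Sat ψ (f x) ↔ K.Sat ψ x) (x : K.W) :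
      (∀ y, K'.R i (f x) y → K'.Sat ψ y) ↔ ∀ y, K.R i x y → K.Sat ψ y := by
    constructor
    · intro H y hy
      exact (ih y).1 (H _ (hf.homomorphism i x y hy))
    -- The back condition lifts each accessible state of the target.
    · intro H y' hy'
      obtain ⟨y, rfl, hy⟩ := hf.back i x y' hy'
      exact (ih y).2 (H y hy)
  induction φ generalizing x with
  | top => simp only [Sat]
  | atom p =>
    have hp : p ∈ Ψ := hφ rfl
    have := hf.atomicHarmony ⟨p, hp⟩ x
    exact ⟨fun ⟨_, H⟩ => ⟨h hp, this.2 H⟩, fun ⟨_, H⟩ => ⟨hp, this.1 H⟩⟩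
  | neg φ ih => simp only [Sat, ih hφ]
  | conj φ ψ ih₁ ih₂ =>
    simp only [Sat, ih₁ (Set.subset_union_left.trans hφ), ih₂ (Set.subset_union_right.trans hφ)]
  | ell i φ ih => exact box_iff i φ (ih hφ) x
  | aware i φ => exact aware_iff i φ hφ x
  | know i φ ih => exact and_congr (box_iff i φ (ih hφ) x) (aware_iff i φ hφ x)

end FHModel

/-! ### Soundness for FH models of the whole language -/

section Soundness

variable {At : Type u} {I : Type v}

/-- The awareness axioms hold because awareness depends only on the set of atoms; introspection of
awareness holds because awareness sets are constant along accessibility; T, 4 and 5 come from the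
equivalence relations. The full set of atoms matters for modus ponens, whose premises may contain
atoms absent from the conclusion. -/
theorem LPATop_sound_FHModel (K : FHModel.{u, v, w} At I Set.univ) {φ : Formula At I}
    (hφ : φ ∈ LPATop At I) (x : K.W) : K.Sat φ x := by
  have gen (i : I) (x : K.W) (ψ : Formula At I) :
      ψ ∈ K.A i x ↔ ∀ p ∈ ψ.atoms, Formula.atom p ∈ K.A i x :=
    K.generated i x ψ (Set.subset_univ _)
  have hφ' : LPAWith (Set.range fun i : I => Formula.aware i Formula.top) φ := hφ
  clear hφ
  induction hφ' generalizing x with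
  | extra h =>
    obtain ⟨i, rfl⟩ := h
    exact (gen i x _).2 fun p hp => hp.elim
  | taut h => exact (K.propEval_sat _ x).1 (h _)
  | axK i φ ψ =>
    rw [FHModel.sat_imp]
    rintro ⟨h₁, h₂⟩ y hy
    exact (K.sat_imp φ ψ y).1 (h₂ y hy) (h₁ y hy)
  | explicitKnowledge i φ => rw [FHModel.sat_biimp]; simp only [FHModel.Sat]
  | axA1 i φ ψ =>
    rw [FHModel.sat_biimp]
    simp only [FHModel.Sat]
    rw [gen i x (.conj φ ψ), gen i x φ, gen i x ψ]
    simp only [Formula.atoms, Set.mem_union, or_imp, forall_and]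
  | axA2 i φ =>
    rw [FHModel.sat_biimp]; simp only [FHModel.Sat]
    rw [gen i x (.neg φ), gen i x φ]; rfl
  | axA3 i j φ =>
    rw [FHModel.sat_biimp]; simp only [FHModel.Sat]
    rw [gen i x (.know j φ), gen i x φ]; rfl
  | axA4 i j φ =>
    rw [FHModel.sat_biimp]; simp only [FHModel.Sat]
    rw [gen i x (.aware j φ), gen i x φ]; rfl
  | axA5 i j φ =>
    rw [FHModel.sat_biimp]; simp only [FHModel.Sat]
    rw [gen i x (.ell j φ), gen i x φ]; rfl
  | axA11 i φ =>
    rw [FHModel.sat_imp]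
    intro h y hy
    simpa only [FHModel.Sat, K.knowAware i x y hy] using h
  | axA12 i φ =>
    rw [FHModel.sat_imp]
    intro h y hy
    simpa only [FHModel.Sat, K.knowAware i x y hy] using h
  | modusPonens _ _ ih₁ ih₂ => exact (K.sat_imp _ _ x).1 (ih₂ x) (ih₁ x)
  | necessitation i _ ih => exact fun y _ => ih y
  | axT i φ =>
    rw [FHModel.sat_imp]
    exact fun h => h x ((K.partitional i).refl x)
  | ax4 i φ =>
    rw [FHModel.sat_imp]
    exact fun h y hy z hz => h z ((K.partitional i).trans hy hz)
  | ax5 i φ =>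
    rw [FHModel.sat_imp]
    exact fun h y hy h' => h fun z hz =>
      h' z ((K.partitional i).trans ((K.partitional i).symm hy) hz)

theorem LPA_subset_LPATop : LPA At I ⊆ LPATop At I := by
  intro φ hφ
  have hφ' : LPAWith ∅ φ := hφ
  change LPAWith _ φ
  clear hφ
  induction hφ' with
  | extra h => exact h.elim
  | taut h => exact .taut h
  | axK i φ ψ => exact .axK i φ ψ
  | explicitKnowledge i φ => exact .explicitKnowledge i φ
  | axA1 i φ ψ => exact .axA1 i φ ψ
  | axA2 i φ => exact .axA2 i φ
  | axA3 i j φ => exact .axA3 i j φ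
  | axA4 i j φ => exact .axA4 i j φ
  | axA5 i j φ => exact .axA5 i j φ
  | axA11 i φ => exact .axA11 i φ
  | axA12 i φ => exact .axA12 i φ
  | modusPonens _ _ ih₁ ih₂ => exact .modusPonens ih₁ ih₂
  | necessitation i _ ih => exact .necessitation i ih
  | axT i φ => exact .axT i φ
  | ax4 i φ => exact .ax4 i φ
  | ax5 i φ => exact .ax5 i φ

/-- The state is lifted to the model for all atoms, where a whole derivation can be interpreted. -/
theorem LPATop_sound_FHCategories : Sound (LPATop At I) ValidFHCategories.{u, v, w} := by
  intro φ hφ C Ψ hΨ x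
  have hf := C.morphism (Set.subset_univ Ψ)
  obtain ⟨y, rfl⟩ := hf.surjective x
  exact ((C.K Set.univ).sat_map hf φ hΨ y).2 (LPATop_sound_FHModel _ hφ y)

end Soundness

/-! ### Base-spaces and definedness -/

namespace StateSpaces

variable {At : Type u} {I : Type v} {L : StateSpaces.{u, w} At}

theorem definedAt_iff (val : At → L.Event) (φ : Formula At I) (ω : L.Ω) :
    DefinedAt val φ ω ↔ baseSpaceOf val φ ⊆ ω.1 := by
  induction φ with
  | top => simp [DefinedAt, Formula.atoms, baseSpaceOf]
  | atom p =>
    constructor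
    · intro h
      rcases h p rfl with ⟨h, _⟩ | ⟨h, _⟩ <;> exact h
    · rintro h q rfl
      exact (em (L.r h ω.2 ∈ (val q).base)).imp (fun H => ⟨h, H⟩) (fun H => ⟨h, H⟩)
  | conj φ ψ ih₁ ih₂ =>
    rw [baseSpaceOf, Set.union_subset_iff, ← ih₁, ← ih₂]
    simp only [DefinedAt, Formula.atoms, Set.mem_union _ (Formula.atoms φ), or_imp, forall_and]
  | neg φ ih => exact ih
  | ell i φ ih => exact ih
  | aware i φ ih => exact ih
  | know i φ ih => exact ih

/-- A base-space is the join of the base-spaces of the atoms, whatever the valuation. This makes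
awareness in HMS models propositionally determined. -/
theorem baseSpaceOf_subset_iff (val : At → L.Event) (φ : Formula At I) (Φ : Set At) :
    baseSpaceOf val φ ⊆ Φ ↔ ∀ p ∈ φ.atoms, (val p).baseSpace ⊆ Φ := by
  induction φ with
  | top => simp [Formula.atoms, baseSpaceOf]
  | atom p => simp [Formula.atoms, baseSpaceOf]
  | conj φ ψ ih₁ ih₂ =>
    rw [baseSpaceOf, Set.union_subset_iff, ih₁, ih₂]
    simp only [Formula.atoms, Set.mem_union, or_imp, forall_and]
  | neg φ ih => exact ih
  | ell i φ ih => exact ih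
  | aware i φ ih => exact ih
  | know i φ ih => exact ih

theorem proj_self (ω : L.Ω) (h : ω.1 ⊆ ω.1) : L.proj ω ω.1 h = ω := by
  simp only [proj, L.r_id]

theorem proj_proj (ω : L.Ω) {Ψ Υ : Set At} (h : Ψ ⊆ ω.1) (h' : Υ ⊆ Ψ) :
    L.proj (L.proj ω Ψ h) Υ h' = L.proj ω Υ (h'.trans h) := by
  simp only [proj, L.r_comp h h']

/-- Membership is tested in the base-space, and projecting there through an intermediate space
changes nothing. -/
theorem Event.proj_mem_states_iff (E : L.Event) (ω : L.Ω) {Ψ : Set At} (h : Ψ ⊆ ω.1)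
    (hΨ : E.baseSpace ⊆ Ψ) : L.proj ω Ψ h ∈ E.states ↔ ω ∈ E.states := by
  refine ⟨fun ⟨_, H⟩ => ⟨hΨ.trans h, ?_⟩, fun ⟨_, H⟩ => ⟨hΨ, ?_⟩⟩
  · rwa [L.r_comp h hΨ]
  · rwa [L.r_comp h hΨ] at H

end StateSpaces

/-! ### Truth in implicit knowledge-based HMS models -/

namespace ImplicitHMSModel

open StateSpaces

variable {At : Type u} {I : Type v} (M : ImplicitHMSModel.{u, v, w} At I)

theorem index_eq_of_mem_Lam {i : I} {ω ω' : M.Ω} (h : ω' ∈ M.Lam i ω) : ω'.1 = ω.1 := by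
  have := M.Lam_projections i ω ω.1 subset_rfl
  rw [proj_self] at this
  rw [← this] at h
  obtain ⟨_, _, _, rfl⟩ := h
  rfl

/-- Reflexivity carries definedness back from the possibility set. For explicit knowledge the
element used is the projection of the state to its own awareness level. -/
theorem baseSpaceOf_subset_of_sat {φ : Formula At I} {ω : M.Ω} (h : M.Sat φ ω) :
    baseSpaceOf M.val φ ⊆ ω.1 := by
  induction φ generalizing ω with
  | top => exact Set.empty_subset _
  | atom p => exact h.1
  | neg φ => exact h.1
  | conj φ ψ ih₁ ih₂ => exact Set.union_subset (ih₁ h.1) (ih₂ h.2)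
  | ell i φ ih => exact ih (h (M.Lam_reflexivity i ω))
  | aware i φ => exact Set.Subset.trans h (M.lackOfConception i ω)
  | know i φ ih =>
    have := ih (h ⟨ω, M.Lam_reflexivity i ω, M.lackOfConception i ω, rfl⟩)
    exact Set.Subset.trans this (M.lackOfConception i ω)

theorem subset_α_proj_iff (i : I) (ω : M.Ω) {Ψ Υ : Set At} (h : Ψ ⊆ ω.1) (h' : Υ ⊆ Ψ) :
    Υ ⊆ M.α i (M.proj ω Ψ h) ↔ Υ ⊆ M.α i ω := by
  constructor
  · exact fun H => H.trans (M.α_proj_mono i ω Ψ h)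
  · intro H
    -- Projecting on to `Υ` gives awareness level exactly `Υ`, and projection cannot raise the
    -- level.
    have h₁ := M.α_proj_below i ω Υ (h'.trans h) H
    have h₂ := M.α_proj_mono i (M.proj ω Ψ h) Υ h'
    rwa [proj_proj, h₁] at h₂

variable {M} in
-- Projection invariance of `φ` is a hypothesis so that this can serve inside the induction that
-- proves it; the same holds for the next two lemmas.
theorem sat_projSet_iff {φ : Formula At I}
    (hφ : ∀ (ω : M.Ω) (Ψ : Set At) (h : Ψ ⊆ ω.1), baseSpaceOf M.val φ ⊆ Ψ →
      (M.Sat φ (M.proj ω Ψ h) ↔ M.Sat φ ω))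
    (i : I) (ω : M.Ω) {Ψ : Set At} (h : Ψ ⊆ ω.1) (hΨ : baseSpaceOf M.val φ ⊆ Ψ) :
    M.projSet (M.Lam i ω) Ψ ⊆ {ω' | M.Sat φ ω'} ↔ M.Lam i ω ⊆ {ω' | M.Sat φ ω'} := by
  constructor
  · intro H ω' hω'
    have h' : Ψ ⊆ ω'.1 := by rwa [M.index_eq_of_mem_Lam hω']
    exact (hφ ω' Ψ h' hΨ).1 (H ⟨ω', hω', h', rfl⟩)
  · rintro H _ ⟨ω', hω', h', rfl⟩
    exact (hφ ω' Ψ h' hΨ).2 (H hω')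

variable {M} in
-- Truth on the derived possibility set forces `φ` to be defined at the awareness level, which is
-- awareness of `φ`; invariance then makes the projection to that level harmless.
theorem sat_know_iff_of_proj {φ : Formula At I}
    (hφ : ∀ (ω : M.Ω) (Ψ : Set At) (h : Ψ ⊆ ω.1), baseSpaceOf M.val φ ⊆ Ψ →
      (M.Sat φ (M.proj ω Ψ h) ↔ M.Sat φ ω))
    (i : I) (ω : M.Ω) :
    M.Sat (.know i φ) ω ↔ M.Sat (.ell i φ) ω ∧ M.Sat (.aware i φ) ω := by
  have key := sat_projSet_iff hφ i ω (M.lackOfConception i ω)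
  constructor
  · intro H
    have ha : baseSpaceOf M.val φ ⊆ M.α i ω := M.baseSpaceOf_subset_of_sat
      (H ⟨ω, M.Lam_reflexivity i ω, M.lackOfConception i ω, rfl⟩)
    exact ⟨(key ha).1 H, ha⟩
  · exact fun H => (key H.2).2 H.1

variable {M} in
theorem sat_ell_proj_iff_of_proj {φ : Formula At I}
    (hφ : ∀ (ω : M.Ω) (Ψ : Set At) (h : Ψ ⊆ ω.1), baseSpaceOf M.val φ ⊆ Ψ →
      (M.Sat φ (M.proj ω Ψ h) ↔ M.Sat φ ω))
    (i : I) (ω : M.Ω) {Ψ : Set At} (h : Ψ ⊆ ω.1) (hΨ : baseSpaceOf M.val φ ⊆ Ψ) :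
    M.Sat (.ell i φ) (M.proj ω Ψ h) ↔ M.Sat (.ell i φ) ω := by
  have := sat_projSet_iff hφ i ω h hΨ
  rwa [M.Lam_projections i ω Ψ h] at this

/-- Truth at a state and at its projection agree wherever the formula is defined. -/
theorem sat_proj_iff (φ : Formula At I) (ω : M.Ω) (Ψ : Set At) (h : Ψ ⊆ ω.1)
    (hΨ : baseSpaceOf M.val φ ⊆ Ψ) : M.Sat φ (M.proj ω Ψ h) ↔ M.Sat φ ω := by
  induction φ generalizing ω Ψ with
  | top => exact Iff.rfl
  | atom p => exact Event.proj_mem_states_iff (M.val p) ω h hΨ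
  -- A negation is an event by definition, so no induction hypothesis is needed.
  | neg φ ih => exact Event.proj_mem_states_iff (Event.neg _) ω h hΨ
  | conj φ ψ ih₁ ih₂ =>
    have hΨ' := Set.union_subset_iff.1 hΨ
    exact and_congr (ih₁ ω Ψ h hΨ'.1) (ih₂ ω Ψ h hΨ'.2)
  | ell i φ ih => exact sat_ell_proj_iff_of_proj ih i ω h hΨ
  | aware i φ => exact M.subset_α_proj_iff i ω h hΨ
  | know i φ ih =>
    rw [sat_know_iff_of_proj ih, sat_know_iff_of_proj ih, sat_ell_proj_iff_of_proj ih i ω h hΨ]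
    exact and_congr Iff.rfl (M.subset_α_proj_iff i ω h hΨ)

theorem sat_know_iff (i : I) (φ : Formula At I) (ω : M.Ω) :
    M.Sat (.know i φ) ω ↔ M.Sat (.ell i φ) ω ∧ M.Sat (.aware i φ) ω :=
  sat_know_iff_of_proj (M.sat_proj_iff φ) i ω

/-- Negation consults `φ` at the projection to its base-space; invariance transfers this to the
state itself. -/
theorem sat_neg_iff {φ : Formula At I} {ω : M.Ω} (h : baseSpaceOf M.val φ ⊆ ω.1) :
    M.Sat (.neg φ) ω ↔ ¬ M.Sat φ ω := by
  rw [← M.sat_proj_iff φ ω _ h subset_rfl]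
  exact ⟨fun H => H.2, fun H => ⟨h, H⟩⟩

/-- The most expressive state space, as an FH model for the set of all atoms. -/
def topFHModel : FHModel.{u, v, w} At I Set.univ where
  W := M.S Set.univ
  nonempty := M.nonempty Set.univ
  R i s t := (⟨Set.univ, t⟩ : M.Ω) ∈ M.Lam i ⟨Set.univ, s⟩
  A i s := {φ | baseSpaceOf M.val φ ⊆ M.α i ⟨Set.univ, s⟩}
  V p := {s | (⟨Set.univ, s⟩ : M.Ω) ∈ (M.val p).states}
  A_subset _ _ _ _ := Set.subset_univ _
  generated _ _ φ _ := baseSpaceOf_subset_iff M.val φ _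
  knowAware i s t h := by rw [M.awarenessMeasurability i _ _ h]
  partitional i :=
    { refl := fun s => M.Lam_reflexivity i _
      symm := fun h => by rw [M.Lam_stationarity i _ _ h]; exact M.Lam_reflexivity i _
      trans := fun h h' => by rwa [← M.Lam_stationarity i _ _ h] }

theorem topFHModel_sat_iff (φ : Formula At I) (s : M.S Set.univ) :
    M.topFHModel.Sat φ s ↔ M.Sat φ ⟨Set.univ, s⟩ := by
  have ell_iff (i : I) (φ : Formula At I) (s : M.S Set.univ)
      (ih : ∀ s : M.S Set.univ, M.topFHModel.Sat φ s ↔ M.Sat φ ⟨Set.univ, s⟩) :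
      M.topFHModel.Sat (.ell i φ) s ↔ M.Sat (.ell i φ) ⟨Set.univ, s⟩ := by
    constructor
    · rintro H ⟨Φ, t⟩ ht
      obtain rfl : Φ = Set.univ := M.index_eq_of_mem_Lam ht
      exact (ih t).1 (H t ht)
    · exact fun H t ht => (ih t).2 (H ht)
  induction φ generalizing s with
  | top => exact Iff.rfl
  | atom p => exact ⟨fun ⟨_, h⟩ => h, fun h => ⟨trivial, h⟩⟩
  | neg φ ih => exact (not_congr (ih s)).trans (M.sat_neg_iff (Set.subset_univ _)).symm
  | conj φ ψ ih₁ ih₂ => exact and_congr (ih₁ s) (ih₂ s)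
  | ell i φ ih => exact ell_iff i φ s ih
  | aware i φ => exact Iff.rfl
  | know i φ ih =>
    exact (and_congr (ell_iff i φ s ih) Iff.rfl).trans (M.sat_know_iff i φ _).symm

end ImplicitHMSModel

theorem LPATop_sound_ImplicitHMS {At : Type u} {I : Type v} :
    Sound (LPATop At I) ValidImplicitHMS.{u, v, w} := by
  rintro φ hφ M ⟨Ψ, s⟩ hω
  rw [StateSpaces.definedAt_iff] at hω
  obtain ⟨t, rfl⟩ := M.r_surjective (Set.subset_univ Ψ) s
  exact (M.sat_proj_iff φ ⟨Set.univ, t⟩ Ψ (Set.subset_univ Ψ) hω).2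
    ((M.topFHModel_sat_iff φ t).1 (LPATop_sound_FHModel M.topFHModel hφ t))

/-! ### Complemented HMS models as implicit knowledge-based HMS models -/

namespace ComplementedHMSModel

open StateSpaces

variable {At : Type u} {I : Type v} (M : ComplementedHMSModel.{u, v, w} At I)

/-- The index of the space that contains `Pi i ω`. -/
noncomputable def awarenessLevel (i : I) (ω : M.Ω) : Set At :=
  (M.confinement i ω).choose

theorem awarenessLevel_subset (i : I) (ω : M.Ω) : M.awarenessLevel i ω ⊆ ω.1 :=
  (M.confinement i ω).choose_spec.1

theorem index_eq_of_mem_Pi {i : I} {ω ω' : M.Ω} (h : ω' ∈ M.Pi i ω) :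
    ω'.1 = M.awarenessLevel i ω :=
  (M.confinement i ω).choose_spec.2 h

/-- Nonemptiness of the possibility set makes the index of its space unique. -/
theorem Pi_subset_space_iff {i : I} {ω : M.Ω} {Ψ : Set At} :
    M.Pi i ω ⊆ M.space Ψ ↔ M.awarenessLevel i ω = Ψ := by
  constructor
  · intro h
    obtain ⟨ω', hω'⟩ := M.Pi_nonempty i ω
    exact (M.index_eq_of_mem_Pi hω').symm.trans (h hω')
  · rintro rfl ω' hω'
    exact M.index_eq_of_mem_Pi hω'

theorem awarenessLevel_eq_of_Pi_eq {i : I} {ω ω' : M.Ω} (h : M.Pi i ω' = M.Pi i ω) :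
    M.awarenessLevel i ω' = M.awarenessLevel i ω := by
  rw [← Pi_subset_space_iff, h, Pi_subset_space_iff]

theorem proj_awarenessLevel_mem_Pi (i : I) (ω : M.Ω) :
    M.proj ω (M.awarenessLevel i ω) (M.awarenessLevel_subset i ω) ∈ M.Pi i ω := by
  obtain ⟨⟨Φ, s⟩, hs, h, he⟩ := M.generalizedReflexivity i ω
  obtain rfl : Φ = M.awarenessLevel i ω := M.index_eq_of_mem_Pi hs
  rwa [← he] at hs

/-- Explicit possibility is implicit possibility projected to the awareness level. -/
theorem Pi_eq_projSet_Lam (i : I) (ω : M.Ω) :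
    M.Pi i ω = M.projSet (M.Lam i ω) (M.awarenessLevel i ω) := by
  have hp := M.proj_awarenessLevel_mem_Pi i ω
  apply Set.Subset.antisymm
  · intro ω' hω'
    -- The projected set is the implicit possibility set of `ω'`, so reflexivity suffices.
    rw [← M.implicitMeasurability i ω _ (M.Pi_subset_space_iff.2 rfl) ω' hω']
    exact M.Lam_reflexivity i ω'
  · intro ω' hω'
    have hidx : ω'.1 = M.awarenessLevel i ω := by obtain ⟨_, _, _, rfl⟩ := hω'; rfl
    rw [M.Lam_projections i ω _ (M.awarenessLevel_subset i ω)] at hω'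
    -- Explicit measurability and stationarity pass through the projection of `ω` to its awareness
    -- level. The level of `ω'` is then its own space, so `ω'` is its own projection and lies in its
    -- own explicit possibility set.
    have hPi : M.Pi i ω' = M.Pi i ω :=
      (M.explicitMeasurability i _ ω' hω').trans (M.stationarity i ω _ hp)
    have hmem := M.proj_awarenessLevel_mem_Pi i ω'
    have hlev : M.awarenessLevel i ω' = ω'.1 :=
      (M.awarenessLevel_eq_of_Pi_eq hPi).trans hidx.symm
    have : ∀ Ψ (h : Ψ ⊆ ω'.1), Ψ = ω'.1 → M.proj ω' Ψ h = ω' := by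
      rintro _ h rfl
      exact proj_self ω' h
    rwa [this _ _ hlev, hPi] at hmem

theorem awarenessLevel_proj_subset (i : I) (ω : M.Ω) (Ψ : Set At) (h : Ψ ⊆ ω.1) :
    M.awarenessLevel i (M.proj ω Ψ h) ⊆ M.awarenessLevel i ω := by
  obtain ⟨ω', hω', h', -⟩ := M.projectionsPreserveIgnorance i ω Ψ h
    ⟨_, M.proj_awarenessLevel_mem_Pi i ω, subset_rfl, proj_self _ _⟩
  rwa [M.index_eq_of_mem_Pi hω'] at h'

theorem awarenessLevel_proj_of_subset (i : I) (ω : M.Ω) (Ψ : Set At) (h : Ψ ⊆ ω.1)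
    (hΨ : Ψ ⊆ M.awarenessLevel i ω) : M.awarenessLevel i (M.proj ω Ψ h) = Ψ := by
  rw [← Pi_subset_space_iff, ← M.projectionsPreserveKnowledge i ω (M.awarenessLevel i ω) Ψ
    (M.awarenessLevel_subset i ω) hΨ (M.Pi_subset_space_iff.2 rfl)]
  rintro _ ⟨_, _, _, rfl⟩
  rfl

/-- The implicit knowledge-based model with the same implicit possibility correspondences,
and the awareness levels given by the explicit ones. -/
noncomputable def toImplicit : ImplicitHMSModel.{u, v, w} At I where
  toStateSpaces := M.toStateSpaces
  Lam := M.Lam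
  α := M.awarenessLevel
  val := M.val
  Lam_reflexivity := M.Lam_reflexivity
  Lam_stationarity := M.Lam_stationarity
  Lam_projections := M.Lam_projections
  lackOfConception := M.awarenessLevel_subset
  awarenessMeasurability i ω ω' h :=
    M.awarenessLevel_eq_of_Pi_eq (M.explicitMeasurability i ω ω' h)
  α_proj_below := M.awarenessLevel_proj_of_subset
  α_proj_above i ω Ψ h hΨ := by
    refine (M.awarenessLevel_proj_subset i ω Ψ h).antisymm ?_
    -- Projecting further, to the awareness level of `ω` itself, keeps that level, so it cannot have
    -- dropped in between.
    have h₁ := M.awarenessLevel_proj_subset i (M.proj ω Ψ h) _ hΨ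
    rw [proj_proj] at h₁
    rwa [M.awarenessLevel_proj_of_subset i ω _ _ subset_rfl] at h₁
  α_proj_mono := M.awarenessLevel_proj_subset

theorem toImplicit_sat_iff (φ : Formula At I) (ω : M.Ω) :
    M.toImplicit.Sat φ ω ↔ M.Sat φ ω := by
  have hPi : M.toImplicit.derivedPi = M.Pi := by
    funext i ω
    exact (M.Pi_eq_projSet_Lam i ω).symm
  have haw : (fun i ω Φ => Φ ⊆ M.toImplicit.α i ω) =
      fun i (ω : M.Ω) Φ => ∃ Ψ, M.Pi i ω ⊆ M.space Ψ ∧ Φ ⊆ Ψ := by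
    funext i ω Φ
    exact propext ⟨fun h => ⟨_, M.Pi_subset_space_iff.2 rfl, h⟩,
      fun ⟨_, h, h'⟩ => by rwa [← M.Pi_subset_space_iff.1 h] at h'⟩
  unfold ImplicitHMSModel.Sat ComplementedHMSModel.Sat
  rw [hPi, haw]
  rfl

end ComplementedHMSModel

theorem LPATop_sound_ComplementedHMS {At : Type u} {I : Type v} :
    Sound (LPATop At I) ValidComplementedHMS.{u, v, w} := fun φ hφ M ω hω =>
  (M.toImplicit_sat_iff φ ω).1 (LPATop_sound_ImplicitHMS φ hφ M.toImplicit ω hω)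

/-! ### The models generated by a single FH model -/

namespace FHModel

variable {At : Type u} {I : Type v} (K : FHModel.{u, v, w} At I Set.univ)

/-- The restriction of an FH model to the language of `Φ`. -/
def restrict (Φ : Set At) : FHModel.{u, v, w} At I Φ where
  W := K.W
  nonempty := K.nonempty
  R := K.R
  A i x := K.A i x ∩ Formula.sublanguage Φ
  V p := K.V ⟨p, trivial⟩
  A_subset _ _ := Set.inter_subset_right
  generated i x φ hφ := by
    have h := K.generated i x φ (Set.subset_univ _)
    constructor
    · exact fun H p hp => ⟨h.1 H.1 p hp, Set.singleton_subset_iff.2 (hφ hp)⟩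
    · exact fun H => ⟨h.2 fun p hp => (H p hp).1, hφ⟩
  knowAware i x y h := by rw [K.knowAware i x y h]
  partitional := K.partitional

/-- The category of the restrictions of an FH model. -/
def category : FHCategory.{u, v, w} At I where
  K := K.restrict
  f _ x := x
  morphism h :=
    { surjective := fun x => ⟨x, rfl⟩
      atomicHarmony := fun _ _ => Iff.rfl
      awarenessConsistency := fun i x => by
        ext φ
        exact ⟨fun H => ⟨H.1.1, H.2⟩, fun H => ⟨⟨H.1, Set.Subset.trans H.2 h⟩, H.2⟩⟩
      homomorphism := fun _ _ _ H => H
      back := fun _ _ y H => ⟨y, rfl, H⟩ }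
  f_id _ _ := rfl
  f_comp _ _ _ := rfl

/-- The restriction to all atoms is not literally `K`: its awareness sets are intersected with the
full language. -/
theorem category_sat_iff (φ : Formula At I) (x : K.W) :
    (K.category.K Set.univ).Sat φ x ↔ K.Sat φ x := by
  have aware_iff (i : I) (φ : Formula At I) (x : K.W) :
      φ ∈ (K.category.K Set.univ).A i x ↔ φ ∈ K.A i x :=
    ⟨fun h => h.1, fun h => ⟨h, Set.subset_univ _⟩⟩
  have ell_iff (i : I) (φ : Formula At I) (x : K.W)
      (ih : ∀ x : K.W, (K.category.K Set.univ).Sat φ x ↔ K.Sat φ x) :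
      (∀ y, (K.category.K Set.univ).R i x y → (K.category.K Set.univ).Sat φ y) ↔
        ∀ y, K.R i x y → K.Sat φ y :=
    forall_congr' fun y => imp_congr Iff.rfl (ih y)
  induction φ generalizing x with
  | top => exact Iff.rfl
  | atom p => exact Iff.rfl
  | neg φ ih => exact not_congr (ih x)
  | conj φ ψ ih₁ ih₂ => exact and_congr (ih₁ x) (ih₂ x)
  | ell i φ ih => exact ell_iff i φ x ih
  | aware i φ => exact aware_iff i φ x
  | know i φ ih => exact and_congr (ell_iff i φ x ih) (aware_iff i φ x)

/-- The constant projective system on the states of an FH model. -/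
@[reducible]
def stateSpaces : StateSpaces.{u, w} At where
  S _ := K.W
  nonempty _ := K.nonempty
  r _ x := x
  r_surjective _ x := ⟨x, rfl⟩
  r_id _ _ := rfl
  r_comp _ _ _ := rfl

/-- The atoms in `Φ` of which `i` is aware at `x`. -/
def awareAtoms (i : I) (Φ : Set At) (x : K.W) : Set At := {p ∈ Φ | Formula.atom p ∈ K.A i x}

theorem awareAtoms_subset (i : I) (Φ : Set At) (x : K.W) : K.awareAtoms i Φ x ⊆ Φ :=
  fun _ h => h.1

theorem awareAtoms_congr {i : I} {x y : K.W} (h : K.R i x y) (Φ : Set At) :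
    K.awareAtoms i Φ y = K.awareAtoms i Φ x := by
  simp only [awareAtoms, K.knowAware i x y h]

theorem awareAtoms_mono (i : I) {Φ Ψ : Set At} (h : Ψ ⊆ Φ) (x : K.W) :
    K.awareAtoms i Ψ x ⊆ K.awareAtoms i Φ x :=
  fun _ hp => ⟨h hp.1, hp.2⟩

theorem awareAtoms_of_subset {i : I} {Φ Ψ : Set At} {x : K.W} (h : Ψ ⊆ K.awareAtoms i Φ x) :
    K.awareAtoms i Ψ x = Ψ :=
  (K.awareAtoms_subset i Ψ x).antisymm fun _ hp => ⟨hp, (h hp).2⟩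

theorem awareAtoms_of_superset {i : I} {Φ Ψ : Set At} {x : K.W} (h : Ψ ⊆ Φ)
    (h' : K.awareAtoms i Φ x ⊆ Ψ) : K.awareAtoms i Ψ x = K.awareAtoms i Φ x :=
  (K.awareAtoms_mono i h x).antisymm fun _ hp => ⟨h' hp, hp.2⟩

/-- The accessible states, placed in the space with index `Φ`. -/
def accessible (i : I) (Φ : Set At) (x : K.W) : Set K.stateSpaces.Ω :=
  {ω | ω.1 = Φ ∧ K.R i x ω.2}

theorem accessible_congr {i : I} {x y : K.W} (h : K.R i x y) (Φ : Set At) :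
    K.accessible i Φ y = K.accessible i Φ x := by
  ext ω
  exact and_congr Iff.rfl ⟨(K.partitional i).trans h,
    (K.partitional i).trans ((K.partitional i).symm h)⟩

theorem projSet_accessible {Φ Ψ : Set At} (i : I) (x : K.W) (h : Ψ ⊆ Φ) :
    K.stateSpaces.projSet (K.accessible i Φ x) Ψ = K.accessible i Ψ x := by
  ext ω
  constructor
  · rintro ⟨ω', h', _, rfl⟩
    exact ⟨rfl, h'.2⟩
  · obtain ⟨Υ, y⟩ := ω
    rintro ⟨rfl, hy⟩
    exact ⟨⟨Φ, y⟩, ⟨rfl, hy⟩, h, rfl⟩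

/-- The event that `p` is true, with base-space of index `{p}`. -/
def event (p : At) : K.stateSpaces.Event := ⟨{p}, K.V ⟨p, trivial⟩⟩

/-- The complemented HMS model generated by an FH model. -/
def complementedHMS : ComplementedHMSModel.{u, v, w} At I where
  toStateSpaces := K.stateSpaces
  Pi i ω := K.accessible i (K.awareAtoms i ω.1 ω.2) ω.2
  Pi_nonempty i ω := ⟨⟨K.awareAtoms i ω.1 ω.2, ω.2⟩, rfl, (K.partitional i).refl _⟩
  val := K.event
  confinement i ω := ⟨_, K.awareAtoms_subset i ω.1 ω.2, fun _ h => h.1⟩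
  generalizedReflexivity i ω :=
    ⟨⟨K.awareAtoms i ω.1 ω.2, ω.2⟩, ⟨rfl, (K.partitional i).refl _⟩,
      K.awareAtoms_subset i ω.1 ω.2, rfl⟩
  stationarity := by
    rintro i ω ⟨Φ, y⟩ ⟨rfl, hy⟩
    change K.accessible i (K.awareAtoms i (K.awareAtoms i ω.1 ω.2) y) y = _
    rw [K.awareAtoms_congr hy, K.awareAtoms_of_subset subset_rfl, K.accessible_congr hy]
  projectionsPreserveIgnorance := by
    rintro i ω Ψ h ω' ⟨⟨Φ, y⟩, ⟨rfl, hy⟩, h', he⟩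
    refine ⟨⟨K.awareAtoms i Ψ ω.2, y⟩, ⟨rfl, hy⟩, (K.awareAtoms_mono i h ω.2).trans h', ?_⟩
    -- Projections are identities, so `he` says that `ω'` has underlying state `y`.
    rw [← eq_of_heq (Sigma.mk.inj he).2]
  projectionsPreserveKnowledge := by
    intro i ω Ψ Υ h h' hΨ
    -- The copy of `ω` at its awareness level lies in the possibility set and so determines `Ψ`.
    obtain rfl : K.awareAtoms i ω.1 ω.2 = Ψ :=
      @hΨ ⟨K.awareAtoms i ω.1 ω.2, ω.2⟩ ⟨rfl, (K.partitional i).refl _⟩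
    rw [K.projSet_accessible i ω.2 h']
    change _ = K.accessible i (K.awareAtoms i Υ ω.2) ω.2
    rw [K.awareAtoms_of_subset h']
  Lam i ω := K.accessible i ω.1 ω.2
  Lam_reflexivity i ω := ⟨rfl, (K.partitional i).refl _⟩
  Lam_stationarity := by
    rintro i ω ⟨Φ, y⟩ ⟨rfl, hy⟩
    exact K.accessible_congr hy _
  Lam_projections i ω Ψ h := K.projSet_accessible i ω.2 h
  explicitMeasurability := by
    rintro i ω ⟨Φ, y⟩ ⟨rfl, hy⟩
    change K.accessible i (K.awareAtoms i ω.1 y) y = _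
    rw [K.awareAtoms_congr hy, K.accessible_congr hy]
  implicitMeasurability := by
    rintro i ω Ψ hΨ ⟨Φ, y⟩ hy
    obtain rfl : Φ = Ψ := hΨ hy
    obtain ⟨rfl, hy⟩ := hy
    rw [K.projSet_accessible i ω.2 (K.awareAtoms_subset i ω.1 ω.2)]
    exact K.accessible_congr hy _

/-- The implicit knowledge-based HMS model generated by an FH model. -/
def implicitHMS : ImplicitHMSModel.{u, v, w} At I where
  toStateSpaces := K.stateSpaces
  Lam i ω := K.accessible i ω.1 ω.2
  α i ω := K.awareAtoms i ω.1 ω.2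
  val := K.event
  Lam_reflexivity := K.complementedHMS.Lam_reflexivity
  Lam_stationarity := K.complementedHMS.Lam_stationarity
  Lam_projections := K.complementedHMS.Lam_projections
  lackOfConception i ω := K.awareAtoms_subset i ω.1 ω.2
  awarenessMeasurability := by
    rintro i ω ⟨Φ, y⟩ ⟨rfl, hy⟩
    exact K.awareAtoms_congr hy _
  α_proj_below i ω Ψ h hΨ := K.awareAtoms_of_subset hΨ
  α_proj_above i ω Ψ h hΨ := K.awareAtoms_of_superset h hΨ
  α_proj_mono i ω Ψ h := K.awareAtoms_mono i h ω.2

theorem baseSpaceOf_event (φ : Formula At I) :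
    StateSpaces.baseSpaceOf K.event φ = φ.atoms := by
  induction φ with
  | conj φ ψ ih₁ ih₂ => simp only [StateSpaces.baseSpaceOf, Formula.atoms, ih₁, ih₂]
  | top => rfl
  | atom p => rfl
  | neg φ ih => exact ih
  | ell i φ ih => exact ih
  | aware i φ ih => exact ih
  | know i φ ih => exact ih

/-- Base-spaces here are the sets of atoms, so reaching the base-space means being aware of each
atom. In the top space everything is defined, so negation is classical. -/
theorem implicitHMS_sat_iff (φ : Formula At I) (x : K.W) :
    K.implicitHMS.Sat φ ⟨Set.univ, x⟩ ↔ K.Sat φ x := by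
  have aware_iff (i : I) (φ : Formula At I) (x : K.W) :
      K.implicitHMS.Sat (.aware i φ) ⟨Set.univ, x⟩ ↔ φ ∈ K.A i x := by
    rw [K.generated i x φ (Set.subset_univ _)]
    change StateSpaces.baseSpaceOf K.event φ ⊆ K.awareAtoms i Set.univ x ↔ _
    rw [K.baseSpaceOf_event]
    exact ⟨fun h p hp => (h hp).2, fun h p hp => ⟨trivial, h p hp⟩⟩
  have ell_iff (i : I) (φ : Formula At I) (x : K.W)
      (ih : ∀ x, K.implicitHMS.Sat φ ⟨Set.univ, x⟩ ↔ K.Sat φ x) :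
      K.implicitHMS.Sat (.ell i φ) ⟨Set.univ, x⟩ ↔ K.Sat (.ell i φ) x := by
    constructor
    · exact fun H y hy => (ih y).1 (H ⟨rfl, hy⟩)
    · rintro H ⟨Φ, y⟩ ⟨hΦ, hy⟩
      obtain rfl : Φ = Set.univ := hΦ
      exact (ih y).2 (H y hy)
  induction φ generalizing x with
  | top => exact Iff.rfl
  | atom p => exact ⟨fun ⟨_, h⟩ => ⟨trivial, h⟩, fun ⟨_, h⟩ => ⟨Set.subset_univ _, h⟩⟩
  | neg φ ih => exact (K.implicitHMS.sat_neg_iff (Set.subset_univ _)).trans (not_congr (ih x))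
  | conj φ ψ ih₁ ih₂ => exact and_congr (ih₁ x) (ih₂ x)
  | ell i φ ih => exact ell_iff i φ x ih
  | aware i φ => exact aware_iff i φ x
  | know i φ ih =>
    exact (K.implicitHMS.sat_know_iff i φ _).trans (and_congr (ell_iff i φ x ih) (aware_iff i φ x))

theorem complementedHMS_sat_iff (φ : Formula At I) (ω : K.stateSpaces.Ω) :
    K.complementedHMS.Sat φ ω ↔ K.implicitHMS.Sat φ ω := by
  have hPi : K.implicitHMS.derivedPi = K.complementedHMS.Pi := by
    funext i ω
    exact K.projSet_accessible i ω.2 (K.awareAtoms_subset i ω.1 ω.2)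
  have haw : (fun i ω Φ => Φ ⊆ K.implicitHMS.α i ω) = fun i (ω : K.stateSpaces.Ω) Φ =>
      ∃ Ψ, K.complementedHMS.Pi i ω ⊆ K.stateSpaces.space Ψ ∧ Φ ⊆ Ψ := by
    funext i ω Φ
    refine propext ⟨fun h => ⟨_, fun _ hω' => hω'.1, h⟩, fun ⟨Ψ, h, h'⟩ => ?_⟩
    obtain rfl : K.awareAtoms i ω.1 ω.2 = Ψ :=
      @h ⟨K.awareAtoms i ω.1 ω.2, ω.2⟩ ⟨rfl, (K.partitional i).refl _⟩
    exact h'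
  unfold ImplicitHMSModel.Sat ComplementedHMSModel.Sat
  rw [hPi, haw]
  rfl

theorem sat_of_validFHCategories {φ : Formula At I} (h : ValidFHCategories.{u, v, w} φ)
    (x : K.W) : K.Sat φ x :=
  (K.category_sat_iff φ x).1 (h K.category Set.univ (Set.subset_univ _) x)

theorem sat_of_validImplicitHMS {φ : Formula At I} (h : ValidImplicitHMS.{u, v, w} φ)
    (x : K.W) : K.Sat φ x :=
  (K.implicitHMS_sat_iff φ x).1 (h K.implicitHMS ⟨Set.univ, x⟩
    ((StateSpaces.definedAt_iff _ _ _).2 (Set.subset_univ _)))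

theorem sat_of_validComplementedHMS {φ : Formula At I} (h : ValidComplementedHMS.{u, v, w} φ)
    (x : K.W) : K.Sat φ x :=
  (K.implicitHMS_sat_iff φ x).1 ((K.complementedHMS_sat_iff φ _).1 (h K.complementedHMS
    ⟨Set.univ, x⟩ ((StateSpaces.definedAt_iff _ _ _).2 (Set.subset_univ _))))

end FHModel

/-! ### The canonical model -/

section Canonical

open Formula

variable {At : Type u} {I : Type v}

/-- Sets of formulas that contain the logic and are closed under modus ponens. -/
structure IsTheory (X T : Set (Formula At I)) : Prop where
  logic : ∀ {φ}, LPAWith X φ → φ ∈ T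
  mp : ∀ {φ ψ}, φ ∈ T → imp φ ψ ∈ T → ψ ∈ T

/-- Theories that decide every formula consistently. -/
structure IsCompleteTheory (X T : Set (Formula At I)) : Prop extends IsTheory X T where
  neg_mem_iff : ∀ φ, neg φ ∈ T ↔ φ ∉ T

variable {X : Set (Formula At I)}

theorem isTheory_setOf_LPAWith : IsTheory X {φ | LPAWith X φ} := ⟨id, .modusPonens⟩

namespace IsTheory

variable {T : Set (Formula At I)}

theorem mem_of_taut (hT : IsTheory X T) {φ : Formula At I} (h : IsTautology φ) : φ ∈ T :=
  hT.logic (.taut h)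

/-- The theory generated by `T` and `χ`. -/
theorem adjoin (hT : IsTheory X T) (χ : Formula At I) : IsTheory X {φ | imp χ φ ∈ T} where
  logic {φ} h := hT.mp (hT.logic h) (hT.mem_of_taut fun e => by simp [imp, propEval]; tauto)
  mp {φ ψ} h₁ h₂ := hT.mp h₂ (hT.mp h₁
    (hT.mem_of_taut fun e => by simp only [imp, propEval]; tauto))

/-- Necessitation and K, in the form needed to produce accessible states by the Lindenbaum lemma. -/
theorem box (hT : IsTheory X T) (i : I) : IsTheory X {φ | ell i φ ∈ T} where
  logic h := hT.logic (.necessitation i h)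
  mp {φ ψ} h₁ h₂ := hT.mp (hT.mp h₂ (hT.mp h₁
    (hT.mem_of_taut fun e => by simp only [imp, propEval]; tauto))) (hT.logic (.axK i φ ψ))

/-- The Lindenbaum lemma. -/
theorem exists_isCompleteTheory (hT : IsTheory X T) {φ : Formula At I} (hφ : φ ∉ T) :
    ∃ T', IsCompleteTheory X T' ∧ T ⊆ T' ∧ φ ∉ T' := by
  obtain ⟨M, hTM, hM⟩ := zorn_subset_nonempty {T' | IsTheory X T' ∧ φ ∉ T'} (by
    intro c hc hchain ⟨T₀, hT₀⟩
    refine ⟨⋃₀ c, ⟨⟨fun h => ⟨T₀, hT₀, (hc hT₀).1.logic h⟩, ?_⟩, ?_⟩,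
      fun _ => Set.subset_sUnion_of_mem⟩
    · rintro χ ψ ⟨T₁, hT₁, h₁⟩ ⟨T₂, hT₂, h₂⟩
      rcases hchain.total hT₁ hT₂ with h | h
      · exact ⟨T₂, hT₂, (hc hT₂).1.mp (h h₁) h₂⟩
      · exact ⟨T₁, hT₁, (hc hT₁).1.mp h₁ (h h₂)⟩
    · rintro ⟨T₁, hT₁, h₁⟩
      exact (hc hT₁).2 h₁) T ⟨hT, hφ⟩
  have hMT : IsTheory X M := hM.prop.1
  have hMφ : φ ∉ M := hM.prop.2
  -- `M` is maximal among theories omitting `φ`, so adjoining any new `χ` yields `φ`. If both `χ`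
  -- and its negation were missing, both would imply `φ`, putting `φ` in `M`.
  have key : ∀ χ, χ ∉ M → imp χ φ ∈ M := by
    intro χ hχ
    by_contra hcon
    refine hχ (hM.le_of_ge ⟨hMT.adjoin χ, hcon⟩ ?_ ?_)
    · exact fun ψ hψ => hMT.mp hψ
        (hMT.mem_of_taut fun e => by simp only [imp, propEval]; tauto)
    · exact hMT.mem_of_taut fun e => by simp only [imp, propEval]; tauto
  refine ⟨M, ⟨hMT, fun χ => ⟨fun h₁ h₂ => hMφ ?_, fun h => ?_⟩⟩, hTM, hMφ⟩
  · exact hMT.mp h₂ (hMT.mp h₁ (hMT.mem_of_taut fun e => by simp only [imp, propEval]; tauto))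
  · by_contra h'
    exact hMφ (hMT.mp (key _ h') (hMT.mp (key _ h)
      (hMT.mem_of_taut fun e => by simp only [imp, propEval]; tauto)))

end IsTheory

namespace IsCompleteTheory

variable {T : Set (Formula At I)}

theorem conj_mem_iff (hT : IsCompleteTheory X T) (φ ψ : Formula At I) :
    conj φ ψ ∈ T ↔ φ ∈ T ∧ ψ ∈ T := by
  refine ⟨fun h => ⟨hT.mp h ?_, hT.mp h ?_⟩, fun h => hT.mp h.2 (hT.mp h.1 ?_)⟩ <;>
    exact hT.mem_of_taut fun e => by simp only [imp, propEval]; tauto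

theorem imp_mem_iff (hT : IsCompleteTheory X T) (φ ψ : Formula At I) :
    imp φ ψ ∈ T ↔ (φ ∈ T → ψ ∈ T) := by
  rw [imp, hT.neg_mem_iff, hT.conj_mem_iff, hT.neg_mem_iff]
  tauto

theorem biimp_mem_iff (hT : IsCompleteTheory X T) (φ ψ : Formula At I) :
    biimp φ ψ ∈ T ↔ (φ ∈ T ↔ ψ ∈ T) := by
  rw [biimp, hT.conj_mem_iff, hT.imp_mem_iff, hT.imp_mem_iff]
  tauto

/-- Awareness of a formula reduces to awareness of its atoms, if the axioms `a_i ⊤` are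
available or the formula does not contain `⊤`. -/
theorem aware_mem_iff (hT : IsCompleteTheory X T) (i : I) (φ : Formula At I)
    (h : LPAWith X (aware i top) ∨ φ.TopFree) :
    aware i φ ∈ T ↔ ∀ p ∈ φ.atoms, aware i (atom p) ∈ T := by
  induction φ with
  | top => simpa [TopFree, atoms] using h.imp hT.logic id
  | atom p => simp [atoms]
  | neg φ ih => exact ((hT.biimp_mem_iff _ _).1 (hT.logic (.axA2 i φ))).trans (ih h)
  | conj φ ψ ih₁ ih₂ =>
    rw [(hT.biimp_mem_iff _ _).1 (hT.logic (.axA1 i φ ψ)), hT.conj_mem_iff,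
      ih₁ (h.imp_right And.left), ih₂ (h.imp_right And.right)]
    simp only [atoms, Set.mem_union, or_imp, forall_and]
  | ell j φ ih => exact ((hT.biimp_mem_iff _ _).1 (hT.logic (.axA5 i j φ))).trans (ih h)
  | aware j φ ih => exact ((hT.biimp_mem_iff _ _).1 (hT.logic (.axA4 i j φ))).trans (ih h)
  | know j φ ih => exact ((hT.biimp_mem_iff _ _).1 (hT.logic (.axA3 i j φ))).trans (ih h)

end IsCompleteTheory

theorem Formula.TopFree.topGuarded {φ : Formula At I} (h : φ.TopFree) : φ.TopGuarded := by
  induction φ with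
  | top => trivial
  | atom p => trivial
  | neg φ ih => exact ih h
  | conj φ ψ ih₁ ih₂ => exact ⟨ih₁ h.1, ih₂ h.2⟩
  | ell i φ ih => exact ih h
  | aware i φ => exact h
  | know i φ => exact h

/-- The states of the canonical model. -/
abbrev CanonicalState (X : Set (Formula At I)) : Type (max u v) :=
  {T : Set (Formula At I) // IsCompleteTheory X T}

/-- The canonical accessibility relations. -/
def canonicalRel (i : I) (T T' : CanonicalState X) : Prop := ∀ φ, ell i φ ∈ T.1 → φ ∈ T'.1

theorem canonicalRel_equivalence (i : I) : Equivalence (canonicalRel (X := X) i) where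
  refl T φ h := T.2.mp h (T.2.logic (.axT i φ))
  symm {T T'} h φ hφ := by
    by_contra hcon
    -- Symmetry comes from T and 5: the failure of implicit knowledge at `T` is itself known there,
    -- hence holds at `T'`.
    have h₁ : ell i φ ∉ T.1 := fun h' => hcon (T.2.mp h' (T.2.logic (.axT i φ)))
    have h₂ := h _ (T.2.mp ((T.2.neg_mem_iff _).2 h₁) (T.2.logic (.ax5 i φ)))
    exact (T'.2.neg_mem_iff _).1 h₂ hφ
  trans {T _ _} h h' φ hφ := h' φ (h _ (T.2.mp hφ (T.2.logic (.ax4 i φ))))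

/-- If `φ` is not known, the theory of all known formulas omits it and extends to a complete theory
omitting it. -/
theorem ell_mem_iff_forall_canonicalRel (T : CanonicalState X) (i : I) (φ : Formula At I) :
    ell i φ ∈ T.1 ↔ ∀ T', canonicalRel i T T' → φ ∈ T'.1 := by
  refine ⟨fun h T' hT' => hT' φ h, fun h => ?_⟩
  by_contra hcon
  obtain ⟨T', hT', hsub, hφ⟩ := (T.2.toIsTheory.box i).exists_isCompleteTheory hcon
  exact hφ (h ⟨T', hT'⟩ fun ψ hψ => hsub hψ)

theorem aware_mem_iff_of_canonicalRel {i : I} {T T' : CanonicalState X}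
    (h : canonicalRel i T T') (φ : Formula At I) : aware i φ ∈ T.1 ↔ aware i φ ∈ T'.1 := by
  refine ⟨fun hφ => h _ (T.2.mp hφ (T.2.logic (.axA11 i φ))), fun hφ => ?_⟩
  by_contra hcon
  have := h _ (T.2.mp ((T.2.neg_mem_iff _).2 hcon) (T.2.logic (.axA12 i φ)))
  exact (T'.2.neg_mem_iff _).1 this hφ

/-- The canonical FH model for the set of all atoms. -/
def canonicalModel (X : Set (Formula At I)) [Nonempty (CanonicalState X)] :
    FHModel.{u, v, max u v w} At I Set.univ where
  -- The lift places the model in the universe over which the classes range.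
  W := ULift.{w} (CanonicalState X)
  nonempty := inferInstance
  R i T T' := canonicalRel i T.down T'.down
  -- Defining awareness through atoms makes it propositionally determined even without the axioms
  -- `a_i ⊤`.
  A i T := {φ | ∀ p ∈ φ.atoms, aware i (atom p) ∈ T.down.1}
  V p := {T | atom p.1 ∈ T.down.1}
  A_subset _ _ _ _ := Set.subset_univ _
  generated i T φ _ := by simp [atoms]
  knowAware i T T' h := by
    ext φ
    exact forall₂_congr fun p _ => aware_mem_iff_of_canonicalRel h _
  partitional i :=
    { refl := fun T => (canonicalRel_equivalence i).refl T.down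
      symm := fun h => (canonicalRel_equivalence i).symm h
      trans := fun h₁ h₂ => (canonicalRel_equivalence i).trans h₁ h₂ }

/-- The truth lemma. -/
theorem canonicalModel_sat_iff [Nonempty (CanonicalState X)] (φ : Formula At I)
    (h : (∀ i, LPAWith X (aware i top)) ∨ φ.TopGuarded) (T : CanonicalState X) :
    (canonicalModel.{u, v, w} X).Sat φ ⟨T⟩ ↔ φ ∈ T.1 := by
  have ell_iff (i : I) (φ : Formula At I) (T : CanonicalState X)
      (ih : ∀ T, (canonicalModel.{u, v, w} X).Sat φ ⟨T⟩ ↔ φ ∈ T.1) :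
      (canonicalModel.{u, v, w} X).Sat (.ell i φ) ⟨T⟩ ↔ ell i φ ∈ T.1 := by
    rw [ell_mem_iff_forall_canonicalRel]
    exact ⟨fun H T' hT' => (ih T').1 (H ⟨T'⟩ hT'), fun H T' hT' => (ih T'.down).2 (H _ hT')⟩
  induction φ generalizing T with
  | top => exact iff_of_true trivial (T.2.mem_of_taut fun _ => trivial)
  | atom p => exact ⟨fun ⟨_, h⟩ => h, fun h => ⟨trivial, h⟩⟩
  | neg φ ih => exact (not_congr (ih h T)).trans (T.2.neg_mem_iff φ).symm
  | conj φ ψ ih₁ ih₂ =>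
    exact (and_congr (ih₁ (h.imp_right And.left) T) (ih₂ (h.imp_right And.right) T)).trans
      (T.2.conj_mem_iff φ ψ).symm
  | ell i φ ih => exact ell_iff i φ T (ih h)
  -- Here, and in the awareness part of explicit knowledge, the restriction on `⊤` is used.
  | aware i φ => exact (T.2.aware_mem_iff i φ (h.imp_left fun h => h i)).symm
  | know i φ ih =>
    rw [(T.2.biimp_mem_iff _ _).1 (T.2.logic (.explicitKnowledge i φ)), T.2.conj_mem_iff,
      ← ell_iff i φ T (ih (h.imp_right Formula.TopFree.topGuarded)),
      T.2.aware_mem_iff i φ (h.imp_left fun h => h i)]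
    rfl

/-- A formula that is true in all FH models for the set of all atoms is derivable. -/
theorem LPAWith_of_forall_sat {φ : Formula At I}
    (h : (∀ i, LPAWith X (aware i top)) ∨ φ.TopGuarded)
    (hφ : ∀ (K : FHModel.{u, v, max u v w} At I Set.univ) (x : K.W), K.Sat φ x) :
    LPAWith X φ := by
  by_contra hcon
  obtain ⟨T, hT, -, hTφ⟩ := isTheory_setOf_LPAWith.exists_isCompleteTheory hcon
  have : Nonempty (CanonicalState X) := ⟨⟨T, hT⟩⟩
  exact hTφ ((canonicalModel_sat_iff.{u, v, w} φ h ⟨T, hT⟩).1 (hφ _ _))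

/-- Completeness of both logics for every notion of validity that implies truth in all FH models
for the set of all atoms. -/
theorem completeFor_of_forall_sat {Valid : Formula At I → Prop}
    (hV : ∀ φ, Valid φ →
      ∀ (K : FHModel.{u, v, max u v w} At I Set.univ) (x : K.W), K.Sat φ x) :
    CompleteFor Set.univ (LPATop At I) Valid ∧
      CompleteFor {φ | φ.TopGuarded} (LPA At I) Valid :=
  ⟨fun φ _ h => LPAWith_of_forall_sat.{u, v, w} (Or.inl fun i => .extra ⟨i, rfl⟩) (hV φ h),
    fun φ hφ h => LPAWith_of_forall_sat.{u, v, w} (Or.inr hφ) (hV φ h)⟩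

end Canonical

/-! ### Soundness and completeness for the three classes -/

theorem mainTheorem1 {At : Type u} {I : Type v} [Nonempty At] [Nonempty I] :
    -- the logic with the axioms `a_i ⊤`: sound and complete for the whole language
    ((Sound (LPATop At I) ValidFHCategories.{u, v, max u v w} ∧
        CompleteFor Set.univ (LPATop At I) ValidFHCategories.{u, v, max u v w}) ∧
      (Sound (LPATop At I) ValidComplementedHMS.{u, v, max u v w} ∧
        CompleteFor Set.univ (LPATop At I) ValidComplementedHMS.{u, v, max u v w}) ∧
      (Sound (LPATop At I) ValidImplicitHMS.{u, v, max u v w} ∧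
        CompleteFor Set.univ (LPATop At I) ValidImplicitHMS.{u, v, max u v w})) ∧
    -- the logic without them: sound, and complete for the formulas in which `⊤` is not in the
    -- scope of an awareness or explicit knowledge operator
    ((Sound (LPA At I) ValidFHCategories.{u, v, max u v w} ∧
        CompleteFor {φ | φ.TopGuarded} (LPA At I) ValidFHCategories.{u, v, max u v w}) ∧
      (Sound (LPA At I) ValidComplementedHMS.{u, v, max u v w} ∧
        CompleteFor {φ | φ.TopGuarded} (LPA At I) ValidComplementedHMS.{u, v, max u v w}) ∧
      (Sound (LPA At I) ValidImplicitHMS.{u, v, max u v w} ∧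
        CompleteFor {φ | φ.TopGuarded} (LPA At I) ValidImplicitHMS.{u, v, max u v w})) := by
  have hFH := completeFor_of_forall_sat.{u, v, w} (At := At) (I := I)
    fun _ h K => K.sat_of_validFHCategories h
  have hCompl := completeFor_of_forall_sat.{u, v, w} (At := At) (I := I)
    fun _ h K => K.sat_of_validComplementedHMS h
  have hImpl := completeFor_of_forall_sat.{u, v, w} (At := At) (I := I)
    fun _ h K => K.sat_of_validImplicitHMS h
  exact ⟨⟨⟨LPATop_sound_FHCategories, hFH.1⟩, ⟨LPATop_sound_ComplementedHMS, hCompl.1⟩,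
      ⟨LPATop_sound_ImplicitHMS, hImpl.1⟩⟩,
    ⟨fun φ h => LPATop_sound_FHCategories φ (LPA_subset_LPATop h), hFH.2⟩,
    ⟨fun φ h => LPATop_sound_ComplementedHMS φ (LPA_subset_LPATop h), hCompl.2⟩,
    ⟨fun φ h => LPATop_sound_ImplicitHMS φ (LPA_subset_LPATop h), hImpl.2⟩⟩
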